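/- For a permutation $\sigma=a_1a_2\cdots a_n$ of $\{1,\dots,n\}$ (written in one-line notation) and a permutation $\pi=p_1\cdots p_k$ of $\{1,\dots,k\}$, say that $\sigma$ avoids $\pi$ if there are no indices $i_1<\dots<i_k$ such that $a_{i_1},\dots,a_{i_k}$ are in the same relative order as $p_1,\dots,p_k$. Let $n\ge 1$ and let $$P_n(132,312)=\operatorname{conv}\{(a_1,\dots,a_n)\in\mathbb{R}^n : a_1\cdots a_n \text{ is a permutation of } \{1,\dots,n\} \text{ avoiding both } 132 \text{ and } 312\}.$$ Then the Ehrhart polynomial of $P=P_n(132,312)$ is $\sum_{k=0}^{n-1}(n-1)\!\downarrow_k m^k$, that is, for every integer $m\ge 0$, $$|mP\cap\mathbb{Z}^n|=\sum_{k=0}^{n-1}(n-1)\!\downarrow_k\, m^k,$$ where $mP=\{mx: x\in P\}$ and $N\!\downarrow_k=N(N-1)\cdots(N-k+1)$ is the falling factorial (with $N\!\downarrow_0=1$ and, at $m=k=0$, $m^k=1$). -/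

import Mathlib

open scoped Pointwise

/-- The permutation `σ` of `{1, …, n}` (indexed from `0`, in one-line notation `σ 0, σ 1, …`)
contains the pattern `π`: some subsequence of `σ` is in the same relative order as `π`. -/
def ContainsPattern {n k : ℕ} (σ : Equiv.Perm (Fin n)) (π : Equiv.Perm (Fin k)) : Prop :=
  ∃ f : Fin k → Fin n, StrictMono f ∧ ∀ i j : Fin k, σ (f i) < σ (f j) ↔ π i < π j

/-- `Av_n(Π)`, the permutations of length `n` that avoid every pattern in `Π`;
the patterns may have any lengths. -/
def avoiders (n : ℕ) (Pi : Set (Σ k : ℕ, Equiv.Perm (Fin k))) : Set (Equiv.Perm (Fin n)) :=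
  {σ | ∀ π ∈ Pi, ¬ ContainsPattern σ π.2}

/-- The point `(a_1, …, a_n)` of `ℝⁿ` given by the one-line notation `a_1 … a_n` of `σ`, with
values in `{1, …, n}`. -/
def permPoint {n : ℕ} (σ : Equiv.Perm (Fin n)) : Fin n → ℝ :=
  fun i => ((σ i : ℕ) : ℝ) + 1

/-- The `Π`-avoiding permutohedron `P_n(Π)`. -/
def avoidingPermutohedron (n : ℕ) (Pi : Set (Σ k : ℕ, Equiv.Perm (Fin k))) :
    Set (Fin n → ℝ) :=
  convexHull ℝ (permPoint '' avoiders n Pi)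

/-- The pattern `132`, in one-line notation shifted to start at `0`. -/
def pattern132 : Equiv.Perm (Fin 3) :=
  ⟨![0, 2, 1], ![0, 2, 1], by decide, by decide⟩

/-- The pattern `312`, in one-line notation shifted to start at `0`
(the second list is the inverse permutation). -/
def pattern312 : Equiv.Perm (Fin 3) :=
  ⟨![2, 0, 1], ![1, 2, 0], by decide, by decide⟩

/-- The lattice points `ℤⁿ` in `ℝⁿ`. -/
def integerPoints (n : ℕ) : Set (Fin n → ℝ) :=
  {x | ∀ i, ∃ z : ℤ, x i = (z : ℝ)}

/-- `p` is the Ehrhart polynomial of `P`: for every natural number `m`, the dilate `mP` contains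
finitely many lattice points, and their number is `p(m)`. -/
def IsEhrhartPolynomial {n : ℕ} (P : Set (Fin n → ℝ)) (p : Polynomial ℚ) : Prop :=
  ∀ m : ℕ, (((m : ℝ) • P) ∩ integerPoints n).Finite ∧
    (((((m : ℝ) • P) ∩ integerPoints n).ncard : ℕ) : ℚ) = p.eval (m : ℚ)

/-!
A permutation avoids `132` and `312` exactly when no entry lies strictly between two earlier ones,
that is, when every entry is a minimum or a maximum of the entries up to it. Recording by
`εⱼ ∈ {0, 1}` which of the two happens at each position `j` (counted from `0`), the entry at
position `i` is `(i + 1) + ∑_{j > i} εⱼ - i εᵢ` (`val_eq_extremalEntry`, `extremalEntry_eq_edgeMap`).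
This is affine in `ε`, and every `ε` occurs, so `P_n(132, 312)` is the image of the cube `[0, 1]ⁿ`
under an affine map, and `m P` the image of `[0, m]ⁿ` under a similar one
(`smul_avoidingPermutohedron`).

Fixing the last coordinate of a point of this parallelepiped leaves a point of the parallelepiped of
one dimension less, translated by some `(s, …, s)` (`mem_shiftedDilate_succ`). If all the
coordinates are integers, then the translation occurring in dimension `k` has the form `y / k` with
`y` an integer, and the translations `z / k` reachable from `y / (k + 1)` are those with
`y / (k + 1) ≤ z / k ≤ y / (k + 1) + m` (`mem_latticePoints_iff`). There are `k m + 1` such `z`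
when `k + 1` divides `y` and `k m` otherwise, and `m + 1` respectively `m` of them are multiples
of `k`. With `a k` the claimed count, which satisfies `a (k + 1) = 1 + k m a k`, it follows by
induction that the number of lattice points in dimension `k` is `a k` when `k` divides `y` and
`a k - a (k - 1)` otherwise (`card_latticePoints`). The polytope itself is the case `y = 0`.
-/

/-! ### The avoiding permutations -/

/-- The entry in position `i` (both counted from `0`) of the permutation in which, for each `j` with
`ε j`, the entry in position `j` is below all earlier entries, and for the other `j` above them. -/
def extremalEntry {n : ℕ} (ε : Fin n → Prop) [DecidablePred ε] (i : Fin n) : ℕ :=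
  (if ε i then 0 else (i : ℕ)) + (Finset.univ.filter fun j => i < j ∧ ε j).card

section extremalEntry

variable {n : ℕ} (ε : Fin n → Prop) [DecidablePred ε]

theorem extremalEntry_lt_of_eps {i j : Fin n} (hij : i < j) (hj : ε j) :
    extremalEntry ε j < extremalEntry ε i := by
  have h : (Finset.univ.filter fun l => j < l ∧ ε l).card
      < (Finset.univ.filter fun l => i < l ∧ ε l).card := by
    apply Finset.card_lt_card
    rw [Finset.ssubset_iff_of_subset]
    · exact ⟨j, by simp [hij, hj], by simp⟩
    · intro l hl
      simp only [Finset.mem_filter, Finset.mem_univ, true_and] at hl ⊢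
      exact ⟨hij.trans hl.1, hl.2⟩
  simp only [extremalEntry, hj, if_true]
  omega

theorem extremalEntry_lt_of_not_eps {i j : Fin n} (hij : i < j) (hj : ¬ ε j) :
    extremalEntry ε i < extremalEntry ε j := by
  have h : (Finset.univ.filter fun l => i < l ∧ ε l)
      ⊆ Finset.Ioo i j ∪ (Finset.univ.filter fun l => j < l ∧ ε l) := by
    intro l hl
    simp only [Finset.mem_filter, Finset.mem_univ, true_and, Finset.mem_union,
      Finset.mem_Ioo] at hl ⊢
    rcases lt_trichotomy l j with h | h | h
    · exact Or.inl ⟨hl.1, h⟩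
    · exact absurd (h ▸ hl.2) hj
    · exact Or.inr ⟨h, hl.2⟩
  have h1 := (Finset.card_le_card h).trans (Finset.card_union_le _ _)
  rw [Fin.card_Ioo] at h1
  have h2 : (i : ℕ) < j := hij
  simp only [extremalEntry, hj, if_false]
  split_ifs <;> omega

theorem extremalEntry_lt (i : Fin n) : extremalEntry ε i < n := by
  have h : (Finset.univ.filter fun l => i < l ∧ ε l) ⊆ Finset.Ioi i := by
    intro l hl
    simp only [Finset.mem_filter, Finset.mem_univ, true_and, Finset.mem_Ioi] at hl ⊢
    exact hl.1
  have h1 := Finset.card_le_card h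
  rw [Fin.card_Ioi] at h1
  have := i.2
  simp only [extremalEntry]
  split_ifs <;> omega

theorem extremalEntry_injective : Function.Injective (extremalEntry ε) := by
  intro i j h
  by_contra hne
  wlog hij : i < j generalizing i j
  · exact this h.symm (Ne.symm hne) (lt_of_le_of_ne (not_lt.mp hij) (Ne.symm hne))
  by_cases hj : ε j
  · exact absurd h (extremalEntry_lt_of_eps ε hij hj).ne'
  · exact absurd h (extremalEntry_lt_of_not_eps ε hij hj).ne

/-- The permutation whose entry in position `j` is below or above all earlier entries, according
to whether `ε j` holds. -/
noncomputable def extremalPerm : Equiv.Perm (Fin n) :=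
  Equiv.ofBijective (fun i => ⟨extremalEntry ε i, extremalEntry_lt ε i⟩) <|
    Finite.injective_iff_bijective.mp fun _ _ h =>
      extremalEntry_injective ε (congrArg Fin.val h)

theorem extremalPerm_apply (i : Fin n) : (extremalPerm ε i : ℕ) = extremalEntry ε i := rfl

end extremalEntry

/-- Avoiding `132` and `312` means that no entry lies strictly between two earlier entries. -/
theorem mem_avoiders_iff {n : ℕ} (σ : Equiv.Perm (Fin n)) :
    σ ∈ avoiders n {⟨3, pattern132⟩, ⟨3, pattern312⟩} ↔
      ∀ i j k : Fin n, i < k → j < k → ¬ (σ i < σ k ∧ σ k < σ j) := by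
  simp only [avoiders, Set.mem_insert_iff, Set.mem_singleton_iff, Set.mem_ofPred_eq,
    forall_eq_or_imp, forall_eq]
  constructor
  · rintro ⟨h1, h2⟩ i j k hik hjk ⟨hσ1, hσ2⟩
    have hσ3 := hσ1.trans hσ2
    rcases lt_trichotomy i j with hij | hij | hij
    · refine h1 ⟨![i, j, k], ?_, ?_⟩
      · rw [Fin.strictMono_iff_lt_succ]
        intro a; fin_cases a <;> simp [hij, hjk]
      · intro a b
        fin_cases a <;> fin_cases b <;>
          simp [pattern132, hσ1, hσ2, hσ3, hσ1.le, hσ2.le, hσ3.le]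
    · exact absurd (hij ▸ hσ3) (lt_irrefl _)
    · refine h2 ⟨![j, i, k], ?_, ?_⟩
      · rw [Fin.strictMono_iff_lt_succ]
        intro a; fin_cases a <;> simp [hij, hik]
      · intro a b
        fin_cases a <;> fin_cases b <;>
          simp [pattern312, hσ1, hσ2, hσ3, hσ1.le, hσ2.le, hσ3.le]
  · intro h
    constructor
    · rintro ⟨f, hf, hp⟩
      exact h (f 0) (f 1) (f 2) (hf (by decide)) (hf (by decide))
        ⟨(hp 0 2).mpr (by decide), (hp 2 1).mpr (by decide)⟩
    · rintro ⟨f, hf, hp⟩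
      exact h (f 1) (f 0) (f 2) (hf (by decide)) (hf (by decide))
        ⟨(hp 1 2).mpr (by decide), (hp 2 0).mpr (by decide)⟩

theorem extremalPerm_mem_avoiders {n : ℕ} (ε : Fin n → Prop) [DecidablePred ε] :
    extremalPerm ε ∈ avoiders n {⟨3, pattern132⟩, ⟨3, pattern312⟩} := by
  rw [mem_avoiders_iff]
  rintro i j k hik hjk ⟨h1, h2⟩
  rw [Fin.lt_def, extremalPerm_apply, extremalPerm_apply] at h1 h2
  by_cases hk : ε k
  · exact absurd h1 (extremalEntry_lt_of_eps ε hik hk).not_gt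
  · exact absurd h2 (extremalEntry_lt_of_not_eps ε hjk hk).not_gt

/-- Every avoider is an `extremalPerm`: its entry at `i` is the number of positions with a smaller
entry, and each position `j > i` contributes to it exactly when the entry at `j` is a new minimum. -/
theorem val_eq_extremalEntry {n : ℕ} {σ : Equiv.Perm (Fin n)}
    (hσ : σ ∈ avoiders n {⟨3, pattern132⟩, ⟨3, pattern312⟩}) (i : Fin n) :
    (σ i : ℕ) = extremalEntry (fun k => ∀ j < k, σ k < σ j) i := by
  rw [mem_avoiders_iff] at hσ
  have key : ∀ {j k : Fin n}, j < k → (σ k < σ j ↔ ∀ l < k, σ k < σ l) := by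
    intro j k hjk
    refine ⟨fun h l hl => ?_, fun h => h j hjk⟩
    by_contra hlt
    exact hσ l j k hl hjk
      ⟨lt_of_le_of_ne (not_lt.mp hlt) fun he => hl.ne (σ.injective he), h⟩
  have hcount : (σ i : ℕ) = (Finset.univ.filter fun j => σ j < σ i).card := by
    rw [← Fin.card_Iio (σ i), ← Finset.card_map σ.symm.toEmbedding]
    congr 1
    ext j
    simp [Finset.mem_map_equiv]
  have hsplit : (Finset.univ.filter fun j => σ j < σ i)
      = (Finset.univ.filter fun j => j < i ∧ σ j < σ i)
        ∪ (Finset.univ.filter fun j => i < j ∧ ∀ l < j, σ j < σ l) := by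
    ext j
    simp only [Finset.mem_filter, Finset.mem_univ, true_and, Finset.mem_union]
    rcases lt_trichotomy j i with h | h | h
    · simp [h, h.not_gt]
    · simp [h]
    · simp [h, h.not_gt, key h]
  have hdisj : Disjoint (Finset.univ.filter fun j => j < i ∧ σ j < σ i)
      (Finset.univ.filter fun j => i < j ∧ ∀ l < j, σ j < σ l) := by
    rw [Finset.disjoint_left]
    intro j hj hj'
    simp only [Finset.mem_filter, Finset.mem_univ, true_and] at hj hj'
    exact hj.1.not_gt hj'.1
  rw [hcount, hsplit, Finset.card_union_of_disjoint hdisj, extremalEntry]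
  congr 1
  split_ifs with h
  · rw [Finset.card_eq_zero, Finset.filter_eq_empty_iff]
    rintro j - ⟨hj, hj'⟩
    exact (h j hj).not_gt hj'
  · rw [← Fin.card_Iio i]
    congr 1
    ext j
    simp only [Finset.mem_filter, Finset.mem_univ, true_and, Finset.mem_Iio, and_iff_left_iff_imp]
    intro hj
    exact lt_of_le_of_ne (not_lt.mp fun hlt => h ((key hj).mp hlt))
      fun he => hj.ne (σ.injective he)

/-! ### The polytope as a parallelepiped -/

/-- The linear map `t ↦ ∑ⱼ tⱼ (e₀ + ⋯ + eⱼ₋₁ - j eⱼ)`, whose values on the standard basis are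
the edge directions of `P_n(132, 312)`. -/
def edgeMap (n : ℕ) : (Fin n → ℝ) →ₗ[ℝ] (Fin n → ℝ) where
  toFun t i := (∑ j, if i < j then t j else 0) - (i : ℕ) * t i
  map_add' s t := by
    ext i
    have : (∑ j, if i < j then s j + t j else 0)
        = (∑ j, if i < j then s j else 0) + ∑ j, if i < j then t j else 0 := by
      rw [← Finset.sum_add_distrib]
      exact Finset.sum_congr rfl fun j _ => by split_ifs <;> simp
    simp only [Pi.add_apply, this]
    ring
  map_smul' c t := by
    ext i
    simp only [Pi.smul_apply, smul_eq_mul, RingHom.id_apply, mul_sub, Finset.mul_sum, mul_ite,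
      mul_zero]
    ring

theorem edgeMap_apply {n : ℕ} (t : Fin n → ℝ) (i : Fin n) :
    edgeMap n t i = (∑ j, if i < j then t j else 0) - (i : ℕ) * t i := rfl

theorem extremalEntry_eq_edgeMap {n : ℕ} (ε : Fin n → Prop) [DecidablePred ε] (i : Fin n) :
    (extremalEntry ε i : ℝ) = (i : ℕ) + edgeMap n (fun j => if ε j then 1 else 0) i := by
  rw [edgeMap_apply, extremalEntry, Finset.card_filter]
  push_cast
  simp only [ite_and]
  split_ifs <;> ring

theorem image_permPoint_avoiders (n : ℕ) :
    permPoint '' avoiders n {⟨3, pattern132⟩, ⟨3, pattern312⟩} =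
      (fun t => edgeMap n t + fun i : Fin n => ((i : ℕ) : ℝ) + 1) ''
        Set.univ.pi fun _ => ({0, 1} : Set ℝ) := by
  classical
  ext x
  constructor
  · rintro ⟨σ, hσ, rfl⟩
    refine ⟨fun k => if ∀ j < k, σ k < σ j then 1 else 0, ?_, ?_⟩
    · intro i _
      dsimp only
      split_ifs <;> simp
    · ext i
      have h := extremalEntry_eq_edgeMap (fun k => ∀ j < k, σ k < σ j) i
      rw [← val_eq_extremalEntry hσ] at h
      simp only [Pi.add_apply, permPoint, h]
      ring
  · rintro ⟨t, ht, rfl⟩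
    refine ⟨extremalPerm fun j => t j = 1, extremalPerm_mem_avoiders _, ?_⟩
    have hte : (fun j => if t j = 1 then (1 : ℝ) else 0) = t := by
      ext j
      rcases ht j (Set.mem_univ j) with h | h
      · simp [h]
      · simp [Set.mem_singleton_iff.mp h]
    ext i
    rw [permPoint, extremalPerm_apply, extremalEntry_eq_edgeMap, hte]
    simp only [Pi.add_apply]
    ring

theorem avoidingPermutohedron_eq_image_cube (n : ℕ) :
    avoidingPermutohedron n {⟨3, pattern132⟩, ⟨3, pattern312⟩} =
      (fun t => edgeMap n t + fun i : Fin n => ((i : ℕ) : ℝ) + 1) ''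
        Set.univ.pi fun _ => Set.Icc (0 : ℝ) 1 := by
  have h := ((edgeMap n).toAffineMap + AffineMap.const ℝ (Fin n → ℝ)
    (fun i : Fin n => ((i : ℕ) : ℝ) + 1)).image_convexHull (Set.univ.pi fun _ => ({0, 1} : Set ℝ))
  rw [convexHull_pi, convexHull_pair, segment_eq_Icc zero_le_one] at h
  rw [avoidingPermutohedron, image_permPoint_avoiders]
  exact h.symm

/-- The parallelepiped `m • P_k(132, 312)`, translated by `(s, …, s)`. The translates are what
remains of the dilated polytope of larger dimension when its last coordinates are fixed. -/
def shiftedDilate (m k : ℕ) (s : ℝ) : Set (Fin k → ℝ) :=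
  {x | ∃ t : Fin k → ℝ, (∀ i, t i ∈ Set.Icc (0 : ℝ) m) ∧
    ∀ i, x i = m * ((i : ℕ) + 1) + s + edgeMap k t i}

theorem smul_avoidingPermutohedron (m n : ℕ) :
    (m : ℝ) • avoidingPermutohedron n {⟨3, pattern132⟩, ⟨3, pattern312⟩}
      = shiftedDilate m n 0 := by
  rw [avoidingPermutohedron_eq_image_cube]
  ext x
  rw [Set.mem_smul_set]
  constructor
  · rintro ⟨_, ⟨t, ht, rfl⟩, rfl⟩
    refine ⟨(m : ℝ) • t, fun i => ?_, fun i => ?_⟩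
    · obtain ⟨h0, h1⟩ := ht i (Set.mem_univ i)
      simp only [Pi.smul_apply, smul_eq_mul]
      exact ⟨by positivity, mul_le_of_le_one_right (by positivity) h1⟩
    · simp only [map_smul, Pi.smul_apply, Pi.add_apply, smul_eq_mul]
      ring
  · rintro ⟨t, ht, hx⟩
    -- for `m = 0` the only admissible `t` is `0`, so `t / 0 = 0` is the right choice there too
    have hmt : (m : ℝ) • (fun i => t i / m) = t := by
      ext i
      rcases Nat.eq_zero_or_pos m with rfl | hm
      · have := ht i
        simp only [Nat.cast_zero, Set.Icc_self, Set.mem_singleton_iff] at this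
        simp [this]
      · have : (m : ℝ) ≠ 0 := by positivity
        simp only [Pi.smul_apply, smul_eq_mul]
        field_simp
    refine ⟨_, ⟨fun i => t i / m, fun i _ => ?_, rfl⟩, ?_⟩
    · obtain ⟨h0, h1⟩ := ht i
      exact ⟨by positivity, div_le_one_of_le₀ h1 (by positivity)⟩
    · rw [smul_add, ← map_smul, hmt]
      ext i
      simp only [Pi.smul_apply, Pi.add_apply, smul_eq_mul, hx]
      ring

theorem mem_shiftedDilate_succ {m k : ℕ} {s : ℝ} {x : Fin (k + 1) → ℝ} :
    x ∈ shiftedDilate m (k + 1) s ↔ ∃ τ ∈ Set.Icc (0 : ℝ) m,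
      x (Fin.last k) = m * (k + 1) + s - k * τ ∧ Fin.init x ∈ shiftedDilate m k (s + τ) := by
  constructor
  · rintro ⟨t, ht, hx⟩
    refine ⟨t (Fin.last k), ht _, ?_, Fin.init t, fun i => ht _, fun i => ?_⟩
    · rw [hx, edgeMap_apply]
      simp [fun j : Fin (k + 1) => (Fin.le_last j).not_gt]
      ring
    · rw [Fin.init, hx, edgeMap_apply, edgeMap_apply]
      simp [Fin.sum_univ_castSucc, Fin.init, Fin.castSucc_lt_last]
      ring
  · rintro ⟨τ, hτ, hl, t, ht, hx⟩
    refine ⟨Fin.snoc t τ, fun i => ?_, fun i => ?_⟩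
    · refine Fin.lastCases ?_ (fun i => ?_) i
      · simpa using hτ
      · simpa using ht i
    · refine Fin.lastCases ?_ (fun i => ?_) i
      · rw [hl, edgeMap_apply]
        simp [fun j : Fin (k + 1) => (Fin.le_last j).not_gt]
        ring
      · have := hx i
        rw [Fin.init, edgeMap_apply] at this
        rw [this, edgeMap_apply]
        simp [Fin.sum_univ_castSucc, Fin.castSucc_lt_last]
        ring

/-! ### Enumerating the lattice points -/

/-- The lattice points of `shiftedDilate m k (y / k)`, enumerated by the value `z` for which the
first `k` coordinates of a point of dimension `k + 1` lie in `shiftedDilate m k (z / k)`; it ranges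
over the integers with `k y ≤ (k + 1) z ≤ k y + k (k + 1) m`. In dimension `0` the translation,
formally `y / 0 = 0`, plays no role. -/
noncomputable def latticePoints (m : ℕ) : (k : ℕ) → ℤ → Finset (Fin k → ℤ)
  | 0, _ => Finset.univ
  | k + 1, y =>
    ((Finset.Icc (k * y / (k + 1)) (k * y / (k + 1) + k * m)).filter
      fun z => k * y ≤ (k + 1) * z).biUnion fun z =>
        (latticePoints m k z).image fun v => Fin.snoc (α := fun _ => ℤ) v (y - z + m * (k + 1))

theorem mem_latticePoints_succ {m k : ℕ} {y : ℤ} {w : Fin (k + 1) → ℤ} :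
    w ∈ latticePoints m (k + 1) y ↔ ∃ z : ℤ, k * y ≤ (k + 1) * z ∧
      (k + 1) * z ≤ k * y + k * (k + 1) * m ∧ w (Fin.last k) = y - z + m * (k + 1) ∧
      Fin.init w ∈ latticePoints m k z := by
  have hpos : (0 : ℤ) < k + 1 := by positivity
  simp only [latticePoints, Finset.mem_biUnion, Finset.mem_filter, Finset.mem_Icc,
    Finset.mem_image]
  refine exists_congr fun z => ?_
  have hub : z ≤ k * y / (k + 1) + k * m ↔ (k + 1) * z ≤ k * y + k * (k + 1) * m := by
    rw [← sub_le_iff_le_add, Int.le_ediv_iff_mul_le hpos]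
    constructor <;> intro h <;> linarith
  constructor
  · rintro ⟨⟨⟨-, h1⟩, h2⟩, v, hv, rfl⟩
    exact ⟨h2, hub.mp h1, by simp, by simpa using hv⟩
  · rintro ⟨h1, h2, h3, h4⟩
    refine ⟨⟨⟨?_, hub.mpr h2⟩, h1⟩, Fin.init w, h4, ?_⟩
    · exact Int.ediv_le_of_le_mul hpos (by linarith)
    · rw [← h3]
      exact Fin.snoc_init_self w

theorem mem_latticePoints_iff {m k : ℕ} {y : ℤ} {w : Fin k → ℤ} :
    w ∈ latticePoints m k y ↔ (fun i => (w i : ℝ)) ∈ shiftedDilate m k (y / k) := by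
  induction k generalizing y with
  | zero =>
    simp only [latticePoints, Finset.mem_univ, true_iff]
    exact ⟨0, fun i => i.elim0, fun i => i.elim0⟩
  | succ k ih =>
    rw [mem_latticePoints_succ, mem_shiftedDilate_succ]
    have hk1 : (0 : ℝ) < k + 1 := by positivity
    have hinit : ∀ s : ℝ, Fin.init (fun i => (w i : ℝ)) ∈ shiftedDilate m k s ↔
        (fun i => (Fin.init w i : ℝ)) ∈ shiftedDilate m k s := fun s => Iff.rfl
    simp only [ih, hinit]
    rcases Nat.eq_zero_or_pos k with rfl | hk
    · -- in dimension `0` the translation is immaterial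
      have hall : ∀ (v : Fin 0 → ℝ) (s : ℝ), v ∈ shiftedDilate m 0 s := fun v s =>
        ⟨0, fun i => i.elim0, fun i => i.elim0⟩
      simp only [hall, and_true]
      constructor
      · rintro ⟨z, h1, h2, h3⟩
        have hz : z = 0 := by push_cast at h1 h2; linarith
        refine ⟨0, ⟨le_rfl, by positivity⟩, ?_⟩
        rw [h3, hz]
        push_cast
        ring
      · rintro ⟨τ, -, h⟩
        refine ⟨0, by simp, by simp, ?_⟩
        have : (w (Fin.last 0) : ℝ) = ((y - 0 + m * (0 + 1) : ℤ) : ℝ) := by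
          rw [h]; push_cast; ring
        exact_mod_cast this
    · have hk0 : (0 : ℝ) < k := by positivity
      constructor
      · rintro ⟨z, h1, h2, h3, h4⟩
        have h1' : (k * y : ℝ) ≤ (k + 1) * z := by exact_mod_cast h1
        have h2' : ((k + 1) * z : ℝ) ≤ k * y + k * (k + 1) * m := by exact_mod_cast h2
        refine ⟨z / k - y / (k + 1), ⟨?_, ?_⟩, ?_, ?_⟩
        · rw [sub_nonneg, div_le_div_iff₀ hk1 hk0]
          linarith
        · rw [sub_le_iff_le_add, div_le_iff₀ hk0]
          have : (m + y / (k + 1) : ℝ) * k = (k * y + k * (k + 1) * m) / (k + 1) := by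
            field_simp; ring
          rw [this, le_div_iff₀ hk1]
          linarith
        · rw [h3]
          push_cast
          field_simp
          ring
        · convert h4 using 2
          push_cast
          ring
      · rintro ⟨τ, ⟨h0, hm⟩, hl, hi⟩
        have hz : k * (y / (k + 1) + τ)
            = ((y + m * (k + 1) - w (Fin.last k) : ℤ) : ℝ) := by
          push_cast at hl ⊢
          rw [hl]
          field_simp
          ring
        have hz' : ((k + 1) * (y + m * (k + 1) - w (Fin.last k) : ℤ) : ℝ)
            = k * y + k * (k + 1) * τ := by
          rw [← hz]
          field_simp
        refine ⟨y + m * (k + 1) - w (Fin.last k), ?_, ?_, by ring, ?_⟩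
        · have : (k * y : ℝ) ≤ (k + 1) * (y + m * (k + 1) - w (Fin.last k) : ℤ) := by
            rw [hz']
            have : (0 : ℝ) ≤ k * (k + 1) * τ := by positivity
            linarith
          exact_mod_cast this
        · have : ((k + 1) * (y + m * (k + 1) - w (Fin.last k) : ℤ) : ℝ)
              ≤ k * y + k * (k + 1) * m := by
            rw [hz']
            gcongr
          exact_mod_cast this
        · convert hi using 1
          rw [← hz]
          push_cast
          field_simp

theorem shiftedDilate_inter_integerPoints (m k : ℕ) :
    shiftedDilate m k 0 ∩ integerPoints k =
      (fun (w : Fin k → ℤ) i => (w i : ℝ)) '' (latticePoints m k 0 : Set (Fin k → ℤ)) := by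
  ext x
  constructor
  · rintro ⟨hx, hint⟩
    choose w hw using hint
    obtain rfl : x = fun i => (w i : ℝ) := funext hw
    exact ⟨w, by simpa [mem_latticePoints_iff] using hx, rfl⟩
  · rintro ⟨w, hw, rfl⟩
    refine ⟨?_, fun i => ⟨w i, rfl⟩⟩
    simpa [mem_latticePoints_iff] using hw

/-! ### Counting the lattice points -/

/-- The claimed number of lattice points of the `m`-th dilate in dimension `n`. -/
def fallingSum (m n : ℕ) : ℤ :=
  ∑ k ∈ Finset.range n, ((n - 1).descFactorial k : ℤ) * (m : ℤ) ^ k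

theorem fallingSum_succ (m n : ℕ) : fallingSum m (n + 1) = 1 + n * m * fallingSum m n := by
  rw [fallingSum, Finset.sum_range_succ', fallingSum, Finset.mul_sum, add_comm]
  refine congrArg₂ _ (by simp) (Finset.sum_congr rfl fun k hk => ?_)
  · obtain ⟨n, rfl⟩ : ∃ n', n = n' + 1 :=
      ⟨n - 1, by have := Finset.mem_range.mp hk; omega⟩
    rw [Nat.add_sub_cancel, Nat.add_sub_cancel, Nat.succ_descFactorial_succ]
    push_cast
    ring

theorem card_filter_dvd_Ioc (q : ℤ) {k : ℕ} (hk : 0 < k) (m : ℕ) :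
    ((Finset.Ioc q (q + k * m)).filter fun z => (k : ℤ) ∣ z).card = m := by
  have hk' : (0 : ℤ) < k := by exact_mod_cast hk
  have h := Int.Ioc_filter_dvd_card q (q + k * m) hk'
  have hdiv : ((q + k * m : ℤ) : ℚ) / (k : ℤ) = q / (k : ℤ) + (m : ℤ) := by
    have : (k : ℚ) ≠ 0 := by positivity
    push_cast
    field_simp
  rw [hdiv, Int.floor_add_intCast, add_sub_cancel_left, max_eq_left (by positivity)] at h
  exact_mod_cast h

theorem card_latticePoints_succ (m k : ℕ) (y : ℤ) :
    (latticePoints m (k + 1) y).card =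
      ∑ z ∈ (Finset.Icc (k * y / (k + 1)) (k * y / (k + 1) + k * m)).filter
        (fun z => k * y ≤ (k + 1) * z), (latticePoints m k z).card := by
  rw [latticePoints, Finset.card_biUnion]
  · refine Finset.sum_congr rfl fun z _ => Finset.card_image_of_injective _ ?_
    intro v w h
    simpa using congrArg Fin.init h
  · intro z _ z' _ hne
    rw [Function.onFun, Finset.disjoint_left]
    intro w hw hw'
    simp only [Finset.mem_image] at hw hw'
    obtain ⟨v, -, rfl⟩ := hw
    obtain ⟨v', -, h⟩ := hw'
    have := congrFun h (Fin.last k)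
    simp only [Fin.snoc_last] at this
    exact hne (by linarith)

/-- The number of lattice points depends only on whether the translation `y / k` is integral. -/
theorem card_latticePoints (m k : ℕ) (y : ℤ) :
    ((latticePoints m (k + 1) y).card : ℤ) =
      fallingSum m (k + 1) - if ((k + 1 : ℕ) : ℤ) ∣ y then 0 else fallingSum m k := by
  induction k generalizing y with
  | zero => simp [latticePoints, fallingSum, Finset.filter_singleton]
  | succ k ih =>
    rw [card_latticePoints_succ]
    simp only [Nat.cast_sum, ih]
    have hIoc : ∀ q : ℤ, ∑ z ∈ Finset.Ioc q (q + (k + 1 : ℕ) * m),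
        (fallingSum m (k + 1) - if ((k + 1 : ℕ) : ℤ) ∣ z then 0 else fallingSum m k)
          = (k + 1) * m * fallingSum m (k + 1) - k * m * fallingSum m k := by
      intro q
      have h1 := card_filter_dvd_Ioc q (Nat.succ_pos k) m
      have h2 := Finset.card_filter_add_card_filter_not (s := Finset.Ioc q (q + (k + 1 : ℕ) * m))
        (fun z => ((k + 1 : ℕ) : ℤ) ∣ z)
      have h3 : ((Finset.Ioc q (q + (k + 1 : ℕ) * m)).card : ℤ) = (k + 1) * m := by
        rw [Int.card_Ioc, add_sub_cancel_left, Int.toNat_of_nonneg (by positivity)]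
        push_cast
        ring
      rw [Nat.succ_eq_add_one] at h1
      rw [h1] at h2
      have h4 := congrArg (Nat.cast : ℕ → ℤ) h2
      rw [h3, Nat.cast_add] at h4
      rw [Finset.sum_sub_distrib, Finset.sum_const, Finset.sum_ite, Finset.sum_const_zero,
        Finset.sum_const, nsmul_eq_mul, nsmul_eq_mul, h3]
      linear_combination (-fallingSum m k) * h4
    have hrec := fallingSum_succ m k
    have hrec' := fallingSum_succ m (k + 1)
    push_cast at hrec'
    set q : ℤ := (k + 1 : ℕ) * y / ((k + 1 : ℕ) + 1) with hq
    by_cases hy : ((k + 1 + 1 : ℕ) : ℤ) ∣ y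
    · -- the translation is integral: the range has both its end points, both multiples of `k + 1`
      obtain ⟨c, rfl⟩ := hy
      have hqc : q = (k + 1 : ℕ) * c := by
        rw [hq]
        apply Int.ediv_eq_of_eq_mul_right (by push_cast; positivity)
        push_cast
        ring
      have hset : (Finset.Icc q (q + (k + 1 : ℕ) * m)).filter
          (fun z => (k + 1 : ℕ) * ((k + 1 + 1 : ℕ) * c) ≤ ((k + 1 : ℕ) + 1) * z)
            = insert q (Finset.Ioc q (q + (k + 1 : ℕ) * m)) := by
        rw [Finset.Ioc_insert_left (le_add_of_nonneg_right (by positivity)),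
          Finset.filter_eq_self]
        intro z hz
        have hz' := (Finset.mem_Icc.mp hz).1
        rw [hqc] at hz'
        push_cast at hz' ⊢
        nlinarith
      rw [hset, Finset.sum_insert (by simp), hIoc, if_pos (hqc ▸ dvd_mul_right _ _),
        if_pos (dvd_mul_right _ _), hrec']
      linear_combination hrec
    · have hlt : ((k + 1 : ℕ) + 1) * q < (k + 1 : ℕ) * y := by
        refine lt_of_le_of_ne (Int.mul_ediv_self_le (by positivity)) fun he => hy ?_
        have hcop : IsCoprime (((k + 1 + 1 : ℕ) : ℤ)) ((k + 1 : ℕ) : ℤ) :=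
          ⟨1, -1, by push_cast; ring⟩
        exact hcop.dvd_of_dvd_mul_left ⟨q, by rw [← he]; push_cast; ring⟩
      have hgt : (k + 1 : ℕ) * y < ((k + 1 : ℕ) + 1) * (q + 1) := by
        have := Int.lt_mul_ediv_self_add (x := (k + 1 : ℕ) * y)
          (k := ((k + 1 : ℕ) + 1 : ℤ)) (by positivity)
        rw [mul_add, mul_one]
        exact this
      have hset : (Finset.Icc q (q + (k + 1 : ℕ) * m)).filter
          (fun z => (k + 1 : ℕ) * y ≤ ((k + 1 : ℕ) + 1) * z)
            = Finset.Ioc q (q + (k + 1 : ℕ) * m) := by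
        ext z
        simp only [Finset.mem_filter, Finset.mem_Icc, Finset.mem_Ioc]
        constructor
        · rintro ⟨⟨h1, h2⟩, h3⟩
          refine ⟨lt_of_le_of_ne h1 ?_, h2⟩
          rintro rfl
          exact absurd h3 hlt.not_ge
        · rintro ⟨h1, h2⟩
          refine ⟨⟨h1.le, h2⟩, hgt.le.trans ?_⟩
          exact mul_le_mul_of_nonneg_left h1 (by positivity)
      rw [hset, hIoc, if_neg hy, hrec']
      linear_combination hrec

theorem mainTheorem7 (n : ℕ) (hn : 1 ≤ n) :
    IsEhrhartPolynomial
      (avoidingPermutohedron n {⟨3, pattern132⟩, ⟨3, pattern312⟩})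
      (∑ k ∈ Finset.range n,
        Polynomial.C (((n - 1).descFactorial k : ℕ) : ℚ) * Polynomial.X ^ k) := by
  intro m
  obtain ⟨k, rfl⟩ : ∃ k, n = k + 1 := ⟨n - 1, by omega⟩
  have hinj : Function.Injective fun (w : Fin (k + 1) → ℤ) i => (w i : ℝ) := fun v w h =>
    funext fun i => Int.cast_injective (congrFun h i)
  rw [smul_avoidingPermutohedron, shiftedDilate_inter_integerPoints]
  refine ⟨(Finset.finite_toSet _).image _, ?_⟩
  rw [Set.ncard_image_of_injective _ hinj, Set.ncard_coe_finset]
  have h := card_latticePoints m k 0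
  rw [if_pos (dvd_zero _), sub_zero, fallingSum] at h
  have h' := congrArg (Int.cast : ℤ → ℚ) h
  push_cast at h'
  rw [h', Polynomial.eval_finsetSum]
  simp
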